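/- A square is a word of the form $xx$ with $x$ a nonempty finite word, and $|x|$ is its period. For a graph $G$ and an integer $k\ge 1$, let $\pi_k(G)$ be the minimum number of colors in a coloring of the vertices of $G$ such that the sequence of colors along a path of $G$ is never a square of period at least $k$. For a class $C$ of graphs let $\pi_k(C)$ be the supremum of $\pi_k(G)$ over the graphs $G\in C$, and let $\mathrm{tree}$ be the class of trees. Then \begin{itemize} \item $\pi_1(\mathrm{tree})=4$; \item $\pi_k(\mathrm{tree})=3$ for $2\le k\le 4$; \item $\pi_k(\mathrm{tree})=2$ for every $k\ge 5$. \end{itemize} These values hold both for the class of finite trees and for the class of all (finite or infinite) trees. -/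

import Mathlib

/-- `l` is a square of period `p`: `l = x x` for a word `x` of length `p`. -/
def IsSquareOfPeriod {α : Type*} (p : ℕ) (l : List α) : Prop :=
  ∃ x : List α, x.length = p ∧ l = x ++ x

/-- The coloring `c` of `G` creates no square of period at least `k`: the sequence of colors along
a path of `G` is never a square of period at least `k`. (A subpath of a path is a path, so this
also says that no factor of such a sequence is a square of period at least `k`.) -/
def AvoidsSquares {V α : Type*} (G : SimpleGraph V) (k : ℕ) (c : V → α) : Prop :=
  ∀ (u v : V) (w : G.Walk u v), w.IsPath →
    ∀ p : ℕ, k ≤ p → ¬ IsSquareOfPeriod p (w.support.map c)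

/-- `π_k(G)`: the minimum number of colors needed to color `G` such that no square of period at
least `k` appears on a path of `G` (it is `⊤` if no finite number of colors suffices). -/
noncomputable def thueNumber {V : Type*} (k : ℕ) (G : SimpleGraph V) : ℕ∞ :=
  ⨅ n ∈ {n : ℕ | ∃ c : V → Fin n, AvoidsSquares G k c}, (n : ℕ∞)

universe u

/-- `π_k(C)`: the supremum of `π_k(G)` over the graphs `G` of the class `C`. -/
noncomputable def classThueNumber (k : ℕ) (C : ∀ V : Type u, SimpleGraph V → Prop) : ℕ∞ :=
  ⨆ (V : Type u) (G : SimpleGraph V) (_ : C V G), thueNumber k G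

/-- The class of all trees, finite or infinite. -/
def TreeClass (V : Type u) (G : SimpleGraph V) : Prop :=
  G.IsTree

/-- The class of finite trees. -/
def FiniteTreeClass (V : Type u) (G : SimpleGraph V) : Prop :=
  Finite V ∧ G.IsTree

/-!
For both classes, the value of `π_k` is decided by words read along *valleys*: a path in a rooted
tree climbs some number of levels and then descends.

*Upper bounds.* Root the tree anywhere and give a vertex at distance `d` from the root the letter
`w d` of an infinite word `w`. Along a path the distances form a valley
(`SimpleGraph.IsTree.exists_dist_eq_valley`), so it suffices that no square of period at least `k`
can be read along a valley of `w` (`ValleySquareFree`); reversing the path, one may assume that the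
lowest level lies in the first half of the square. Such words are the images of a square-free
ternary word under uniform substitutions over 4, 3 and 2 letters, for `k = 1, 2, 5`. Suppose that
a square of period `p` is read along a valley that starts with `a` climbing steps.

* If `a` is large, a factor of fixed length of `w` occurs in `w` together with its reversal, which
  the substitution excludes (`TreeCode.directed`).
* If `a` is small and `p` is large, `w` contains a repetition `u v u` with `|u v| = p` and
  `|v| = a`. The factors of `w` determine their position modulo the block length, so `p` is a
  multiple of the block length and the repetition descends to a square of the ternary word
  (`SyncBlocks.descent`).
* The remaining cases concern finitely many factors and are checked by evaluation
  (`TreeCode.short`).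

The same descent, with `v` empty, shows that the fixed point of Leech's substitution is square-free
(`squareFreeWord_leechWord`).

*Lower bounds.* In a finite complete tree with enough branching, the pigeonhole principle applied
from the leaves upwards produces, for each coloring, a complete binary subtree whose vertices are
colored according to their level (`exists_hasLevels`). Without squares, its sequence of levels is a
good word (`goodWords`), and good words have bounded length: at most 5 for three letters and `k = 1`,
at most 14 for two letters and `k = 4`, less than `2 * k` for one letter.
-/

/-! ### Factors of infinite words and images under uniform substitutions -/

/-- The factor `w n, w (n + 1), …, w (n + len - 1)` of the infinite word `w`. -/
def factor {α : Type*} (w : ℕ → α) (n len : ℕ) : List α :=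
  (List.range' n len).map w

section Factor

variable {α β : Type*}

@[simp]
theorem length_factor (w : ℕ → α) (n len : ℕ) : (factor w n len).length = len := by
  simp [factor]

@[simp]
theorem getElem_factor (w : ℕ → α) (n len t : ℕ) (h : t < (factor w n len).length) :
    (factor w n len)[t] = w (n + t) := by
  simp [factor]

theorem getElem?_factor (w : ℕ → α) {n len t : ℕ} (h : t < len) :
    (factor w n len)[t]? = some (w (n + t)) := by
  rw [List.getElem?_eq_getElem (by simpa using h), getElem_factor]

theorem factor_eq_factor_iff {v w : ℕ → α} {i j len : ℕ} :
    factor v i len = factor w j len ↔ ∀ t < len, v (i + t) = w (j + t) := by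
  constructor
  · intro h t ht
    have := congrArg (·[t]?) h
    simpa [getElem?_factor _ ht] using this
  · intro h
    refine List.ext_getElem (by simp) fun t h₁ _ => ?_
    simpa using h t (by simpa using h₁)

theorem factor_add (w : ℕ → α) (n a b : ℕ) :
    factor w n (a + b) = factor w n a ++ factor w (n + a) b := by
  simp [factor, ← List.map_append, List.range'_append_1]

theorem take_drop_factor (w : ℕ → α) {n r len N : ℕ} (h : r + len ≤ N) :
    ((factor w n N).drop r).take len = factor w (n + r) len := by
  obtain ⟨e, rfl⟩ := Nat.exists_eq_add_of_le h
  rw [add_assoc, factor_add, List.drop_left' (by simp), factor_add, List.take_left' (by simp)]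

/-- The infinite word `w` is the image of the infinite word `z` under the `m`-uniform
substitution `T`. -/
def IsBlockImage (T : α → List β) (m : ℕ) (z : ℕ → α) (w : ℕ → β) : Prop :=
  ∀ i, factor w (m * i) m = T (z i)

variable {T : α → List β} {m : ℕ} {z : ℕ → α} {w : ℕ → β}

theorem IsBlockImage.getElem? (hw : IsBlockImage T m z w) (i : ℕ) {o : ℕ} (ho : o < m) :
    (T (z i))[o]? = some (w (m * i + o)) := by
  rw [← hw i, getElem?_factor _ ho]

theorem IsBlockImage.factor_two (hw : IsBlockImage T m z w) (i : ℕ) :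
    factor w (m * i) (m + m) = T (z i) ++ T (z (i + 1)) := by
  rw [factor_add, hw, ← Nat.mul_succ, hw]

theorem IsBlockImage.factor_three (hw : IsBlockImage T m z w) (i : ℕ) :
    factor w (m * i) (m + m + m) = T (z i) ++ T (z (i + 1)) ++ T (z (i + 2)) := by
  have : m * i + (m + m) = m * (i + 2) := by ring
  rw [factor_add, hw.factor_two, this, hw]

theorem exists_isBlockImage (hT : ∀ a, (T a).length = m) (hm : 0 < m) (z : ℕ → α) :
    ∃ w, IsBlockImage T m z w := by
  have hlt (n : ℕ) : n % m < (T (z (n / m))).length := by rw [hT]; exact Nat.mod_lt _ hm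
  refine ⟨fun n => (T (z (n / m)))[n % m]'(hlt n), fun i => ?_⟩
  refine List.ext_getElem (by simp [hT]) fun t h₁ _ => ?_
  have ht : t < m := by simpa using h₁
  have h1 : (m * i + t) / m = i := by
    rw [Nat.mul_add_div hm, Nat.div_eq_of_lt ht, add_zero]
  have h2 : (m * i + t) % m = t := by
    rw [Nat.mul_add_mod, Nat.mod_eq_of_lt ht]
  simp [h1, h2]

end Factor

/-! ### Descent of repetitions along a synchronizing substitution -/

/-- `w` is square-free: no period `p > 0` is realised by a factor of length `2 * p`. -/
def SquareFreeWord {α : Type*} (w : ℕ → α) : Prop :=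
  ∀ p, 0 < p → ∀ i, ∃ t < p, w (i + t) ≠ w (i + p + t)

theorem SquareFreeWord.ne_succ {α : Type*} {w : ℕ → α} (h : SquareFreeWord w) (i : ℕ) :
    w i ≠ w (i + 1) := by
  obtain ⟨t, ht, hne⟩ := h 1 one_pos i
  obtain rfl : t = 0 := by omega
  simpa using hne

/-- The conditions on an `m`-uniform ternary substitution `T` under which a repetition `u v u` with
`|v| ≤ g` and `|u| ≥ L` in the image of a word comes from a square in the word itself. -/
structure SyncBlocks {α : Type*} (T : Fin 3 → List α) (m g L : ℕ) : Prop where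
  length_eq : ∀ a, (T a).length = m
  pos : 0 < m
  le_succ : L ≤ m + 1
  /-- A factor of length `L` occurs at a single position modulo `m`. -/
  sync : ∀ a b, a ≠ b → ∀ a' b', a' ≠ b' → ∀ r < m, ∀ r' < m,
    ((T a ++ T b).drop r).take L = ((T a' ++ T b').drop r').take L → r = r'
  /-- For a repetition that begins at offset `r` of a block, either the first blocks of the two
  occurrences of `u`, or the last ones, agree on enough positions to be equal. -/
  ident : ∀ r < m,
    (∀ a b, a ≠ b → ∃ o < m, r ≤ o ∧ o + g < m + r ∧ (T a)[o]? ≠ (T b)[o]?) ∨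
    (∀ a b, a ≠ b → ∃ o < m, o + g < r ∧ (T a)[o]? ≠ (T b)[o]?)

section Descent

variable {α : Type*} {T : Fin 3 → List α} {m g L : ℕ} {z : ℕ → Fin 3} {w : ℕ → α}

theorem IsBlockImage.ne_of_getElem?_ne (hw : IsBlockImage T m z w) {i j o : ℕ} (ho : o < m)
    (h : (T (z i))[o]? ≠ (T (z j))[o]?) : w (m * i + o) ≠ w (m * j + o) := by
  rw [hw.getElem? i ho, hw.getElem? j ho] at h
  exact fun h' => h (congrArg some h')

theorem IsBlockImage.factor_eq_of_le_succ (hw : IsBlockImage T m z w) (hm : 0 < m) {len : ℕ}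
    (hlen : len ≤ m + 1) (n : ℕ) :
    factor w n len = ((T (z (n / m)) ++ T (z (n / m + 1))).drop (n % m)).take len := by
  have := Nat.mod_lt n hm
  rw [← hw.factor_two, take_drop_factor _ (by omega), Nat.div_add_mod]

/-- A repetition of large period in the image of `z` descends to a square of `z`. -/
theorem SyncBlocks.descent (hT : SyncBlocks T m g L) (hw : IsBlockImage T m z w)
    (hz : ∀ i, z i ≠ z (i + 1)) {p n : ℕ} (hp0 : 0 < p) (hp : L + g ≤ p)
    (hrep : ∀ t, t + g < p → w (n + t) = w (n + p + t)) :
    ∃ q j, p = m * q ∧ ∀ t < q, z (j + t) = z (j + q + t) := by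
  have hm := hT.pos
  have hmod : n % m = (n + p) % m := by
    have h : factor w n L = factor w (n + p) L :=
      factor_eq_factor_iff.2 fun t ht => hrep t (by omega)
    rw [hw.factor_eq_of_le_succ hm hT.le_succ, hw.factor_eq_of_le_succ hm hT.le_succ] at h
    exact hT.sync _ _ (hz _) _ _ (hz _) _ (Nat.mod_lt _ hm) _ (Nat.mod_lt _ hm) h
  obtain ⟨q, rfl⟩ : m ∣ p := by
    have : n + 0 ≡ n + p [MOD m] := hmod
    exact (Nat.modEq_zero_iff_dvd).1 (Nat.ModEq.add_left_cancel' n this).symm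
  have hq : 0 < q := Nat.pos_of_mul_pos_left hp0
  have hn := Nat.div_add_mod n m
  have hr := Nat.mod_lt n hm
  set i := n / m
  set r := n % m
  rcases hT.ident r hr with h | h
  · refine ⟨q, i, rfl, fun t ht => ?_⟩
    by_contra hne
    obtain ⟨o, ho, hro, hog, hT'⟩ := h _ _ hne
    have hle : m * (t + 1) ≤ m * q := Nat.mul_le_mul_left _ ht
    have e1 : m * (t + 1) = m * t + m := by ring
    refine hw.ne_of_getElem?_ne ho hT' ?_
    have := hrep (m * t + o - r) (by omega)
    convert this using 2
    · rw [mul_add]; omega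
    · rw [mul_add, mul_add]; omega
  · refine ⟨q, i + 1, rfl, fun t ht => ?_⟩
    by_contra hne
    obtain ⟨o, ho, hog, hT'⟩ := h _ _ hne
    have hle : m * (t + 1) ≤ m * q := Nat.mul_le_mul_left _ ht
    have e1 : m * (t + 1) = m * t + m := by ring
    refine hw.ne_of_getElem?_ne ho hT' ?_
    have := hrep (m * (t + 1) + o - r) (by omega)
    convert this using 2
    · rw [mul_add, mul_add, mul_one]; omega
    · rw [mul_add, mul_add, mul_add, mul_one]; omega

end Descent

/-! ### A square-free ternary word -/

/-- Leech's 13-uniform square-free substitution. -/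
def leech : Fin 3 → List (Fin 3) :=
  ![[0, 1, 2, 1, 0, 2, 1, 2, 0, 1, 2, 1, 0],
    [1, 2, 0, 2, 1, 0, 2, 0, 1, 2, 0, 2, 1],
    [2, 0, 1, 0, 2, 1, 0, 1, 2, 0, 1, 0, 2]]

/-- The fixed point of `leech` that begins with `0`. -/
def leechWord : ℕ → Fin 3
  | 0 => 0
  | n + 1 => (leech (leechWord ((n + 1) / 13))).getD ((n + 1) % 13) 0
  decreasing_by omega

theorem isBlockImage_leechWord : IsBlockImage leech 13 leechWord leechWord := by
  have hrec (n : ℕ) : leechWord n = (leech (leechWord (n / 13))).getD (n % 13) 0 := by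
    rcases n with _ | n
    · simp [leechWord, leech]
    · rw [leechWord]
  have hlen : ∀ a, (leech a).length = 13 := by decide
  intro i
  refine List.ext_getElem (by simp [hlen]) fun t h₁ h₂ => ?_
  have ht : t < 13 := by simpa using h₁
  have h1 : (13 * i + t) / 13 = i := by omega
  have h2 : (13 * i + t) % 13 = t := by omega
  rw [getElem_factor, hrec, h1, h2, List.getD_eq_getElem _ _ h₂]

theorem syncBlocks_leech : SyncBlocks leech 13 0 8 where
  length_eq := by decide
  pos := by decide
  le_succ := by decide
  sync := by decide +kernel
  ident := by decide +kernel

theorem leechWord_ne_succ (n : ℕ) : leechWord n ≠ leechWord (n + 1) := by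
  have hcheck : ∀ a b, a ≠ b → ∀ r < 13,
      (leech a ++ leech b)[r]? ≠ (leech a ++ leech b)[r + 1]? := by decide +kernel
  induction n using Nat.strong_induction_on with
  | _ n ih =>
    rcases Nat.eq_zero_or_pos n with rfl | hn
    · simp [leechWord, leech]
    · have := hcheck _ _ (ih (n / 13) (by omega)) (n % 13) (by omega)
      rw [← isBlockImage_leechWord.factor_two, getElem?_factor _ (by omega),
        getElem?_factor _ (by omega), ← add_assoc, Nat.div_add_mod] at this
      exact fun h => this (congrArg some h)

theorem squareFreeWord_leechWord : SquareFreeWord leechWord := by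
  have hcheck : ∀ a b, a ≠ b → ∀ c, b ≠ c → ∀ r < 13, ∀ p < 8, 0 < p →
      (((leech a ++ leech b ++ leech c).drop r).take p) ≠
      (((leech a ++ leech b ++ leech c).drop (r + p)).take p) := by decide +kernel
  intro p
  induction p using Nat.strong_induction_on with
  | _ p ih =>
    intro hp i
    by_contra! hsq
    rcases lt_or_ge p 8 with hp8 | hp8
    · refine hcheck _ _ (leechWord_ne_succ (i / 13)) _ (leechWord_ne_succ (i / 13 + 1)) (i % 13)
        (Nat.mod_lt _ (by decide)) p hp8 hp ?_
      rw [← isBlockImage_leechWord.factor_three, take_drop_factor _ (by omega),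
        take_drop_factor _ (by omega), ← add_assoc, Nat.div_add_mod]
      exact factor_eq_factor_iff.2 hsq
    · obtain ⟨q, j, rfl, hq⟩ := syncBlocks_leech.descent isBlockImage_leechWord
        leechWord_ne_succ hp hp8 hsq
      obtain ⟨t, ht, hne⟩ := ih q (by omega) (by omega) j
      exact hne (hq t ht)

/-! ### Words that stay square-free when read along a valley -/

/-- The `t`-th level visited by a path that climbs `a` levels up to level `n` and descends
afterwards: `n + a, …, n + 1, n, n + 1, …` (that is, `n + |t - a|`). -/
def valley (n a t : ℕ) : ℕ := n + (t - a) + (a - t)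

/-- The word `w` has no square of period `p ≥ k` along a valley whose lowest level lies in the first
half of the square. -/
def ValleySquareFree {α : Type*} (k : ℕ) (w : ℕ → α) : Prop :=
  ∀ n a p, k ≤ p → a < p → ∃ t < p, w (valley n a t) ≠ w (valley n a (t + p))

/-- The finite word `u` has no square of period `p` along a valley whose lowest level is `r` and lies
in the first half of the square. -/
def NoValleySquareAt {α : Type*} (u : List α) (r p : ℕ) : Prop :=
  ∀ a < p, ∃ t < p, u[valley r a t]? ≠ u[valley r a (t + p)]?

instance {α : Type*} [DecidableEq α] (u : List α) (r p : ℕ) : Decidable (NoValleySquareAt u r p) :=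
  inferInstanceAs (Decidable (∀ a < p, ∃ t < p, u[valley r a t]? ≠ u[valley r a (t + p)]?))

/-- The finite conditions on a ternary substitution `T` under which the image of every square-free
ternary word has no square of period at least `k` along a valley. -/
structure TreeCode {α : Type*} (T : Fin 3 → List α) (k m g L : ℕ) : Prop
    extends SyncBlocks T m g L where
  k_pos : 0 < k
  gap_le : g + 1 ≤ m
  /-- No factor of length `g + 2` is the reversal of a factor. -/
  directed : ∀ a b, a ≠ b → ∀ a' b', a' ≠ b' → ∀ r < m, ∀ r' < m,
    ((T a ++ T b).drop r).take (g + 2) ≠ (((T a' ++ T b').drop r').take (g + 2)).reverse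
  short_le : 2 * (L + g) ≤ 2 * m + 3
  /-- There is no square of small period `p` along a valley. The first alternative discards, at
  little cost, most of the pairs of a position and a period. -/
  short : ∀ a b, a ≠ b → ∀ c, b ≠ c → ∀ r < m, ∀ p < L + g, k ≤ p →
    ((T a ++ T b ++ T c).drop r).take (p - g) ≠
      ((T a ++ T b ++ T c).drop (r + p)).take (p - g) ∨
    NoValleySquareAt (T a ++ T b ++ T c) r p

section TreeCode

variable {α : Type*} {T : Fin 3 → List α} {k m g L : ℕ} {z : ℕ → Fin 3} {w : ℕ → α}

theorem TreeCode.not_reversed (hT : TreeCode T k m g L) (hz : SquareFreeWord z)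
    (hw : IsBlockImage T m z w) (i j : ℕ) :
    factor w i (g + 2) ≠ (factor w j (g + 2)).reverse := by
  have hg := hT.gap_le
  rw [hw.factor_eq_of_le_succ hT.pos (by omega), hw.factor_eq_of_le_succ hT.pos (by omega)]
  exact hT.directed _ _ (hz.ne_succ _) _ _ (hz.ne_succ _) _ (Nat.mod_lt _ hT.pos) _
    (Nat.mod_lt _ hT.pos)

theorem TreeCode.valleySquareFree (hT : TreeCode T k m g L) (hz : SquareFreeWord z)
    (hw : IsBlockImage T m z w) : ValleySquareFree k w := by
  intro n s p hk hs
  have hm := hT.pos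
  have hk0 := hT.k_pos
  by_contra! hsq
  have hdown (hsg : s ≤ g) (t : ℕ) (ht : t + g < p) : w (n + t) = w (n + p + t) := by
    have := hsq (t + s) (by omega)
    convert this using 2 <;> (unfold valley; omega)
  rcases lt_or_ge g s with hgs | hsg
  · -- The climb is long: a factor and its reversal both occur.
    refine hT.not_reversed hz hw (n + p - s) (n + s - (g + 1)) ?_
    refine List.ext_getElem (by simp) fun t h₁ _ => ?_
    have ht : t < g + 2 := by simpa using h₁
    have := hsq t (by omega)
    simp only [getElem_factor, List.getElem_reverse, length_factor]
    rw [eq_comm]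
    convert this using 2 <;> (unfold valley; omega)
  rcases lt_or_ge p (L + g) with hp | hp
  · have hle := hT.short_le
    have hr := Nat.mod_lt n hm
    have hn := Nat.div_add_mod n m
    rcases hT.short _ _ (hz.ne_succ (n / m)) _ (hz.ne_succ (n / m + 1)) _ hr p hp hk with h | h
    · rw [← hw.factor_three, take_drop_factor _ (by omega), take_drop_factor _ (by omega),
        ← add_assoc, hn] at h
      exact h (factor_eq_factor_iff.2 fun t ht => hdown hsg t (by omega))
    · obtain ⟨t, ht, hne⟩ := h s hs
      rw [← hw.factor_three, getElem?_factor _ (by unfold valley; omega),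
        getElem?_factor _ (by unfold valley; omega)] at hne
      refine hne (congrArg some ?_)
      convert hsq t ht using 2 <;> (unfold valley; omega)
  · obtain ⟨q, j, rfl, hq⟩ := hT.toSyncBlocks.descent hw hz.ne_succ (by omega) hp (hdown hsg)
    have hq0 : 0 < q := Nat.pos_of_mul_pos_left (by omega : 0 < m * q)
    obtain ⟨t, ht, hne⟩ := hz q hq0 j
    exact hne (hq t ht)

theorem TreeCode.exists_valleySquareFree (hT : TreeCode T k m g L) :
    ∃ w : ℕ → α, ValleySquareFree k w := by
  obtain ⟨w, hw⟩ := exists_isBlockImage hT.length_eq hT.pos leechWord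
  exact ⟨w, hT.valleySquareFree squareFreeWord_leechWord hw⟩

end TreeCode

theorem exists_valleySquareFree_four : ∃ w : ℕ → Fin 4, ValleySquareFree 1 w :=
  TreeCode.exists_valleySquareFree (m := 5) (g := 2) (L := 4)
    (T := ![[2, 3, 1, 2, 0], [1, 2, 3, 1, 0], [3, 1, 2, 3, 0]])
    { length_eq := by decide
      pos := by decide
      le_succ := by decide
      sync := by decide +kernel
      ident := by decide +kernel
      k_pos := by decide
      gap_le := by decide
      directed := by decide +kernel
      short_le := by decide
      short := by decide +kernel }

theorem exists_valleySquareFree_three : ∃ w : ℕ → Fin 3, ValleySquareFree 2 w :=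
  TreeCode.exists_valleySquareFree (m := 12) (g := 1) (L := 10)
    (T := ![[1, 2, 2, 0, 0, 1, 1, 2, 0, 0, 1, 2], [0, 1, 1, 2, 2, 0, 0, 1, 2, 2, 0, 1],
      [2, 0, 0, 1, 1, 2, 2, 0, 1, 1, 2, 0]])
    { length_eq := by decide
      pos := by decide
      le_succ := by decide
      sync := by decide +kernel
      ident := by decide +kernel
      k_pos := by decide
      gap_le := by decide
      directed := by decide +kernel
      short_le := by decide
      short := by decide +kernel }

theorem exists_valleySquareFree_two : ∃ w : ℕ → Fin 2, ValleySquareFree 5 w :=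
  TreeCode.exists_valleySquareFree (m := 28) (g := 9) (L := 18)
    (T := ![
      [0, 0, 0, 1, 0, 0, 1, 1, 0, 1, 0, 1, 0, 0, 0, 1, 1, 1, 0, 1, 1, 0, 0, 1, 0, 1, 1, 1],
      [0, 0, 0, 1, 0, 0, 1, 1, 0, 1, 0, 0, 0, 1, 1, 1, 0, 1, 1, 0, 0, 1, 0, 1, 0, 1, 1, 1],
      [0, 0, 0, 1, 0, 0, 1, 1, 1, 0, 1, 0, 0, 0, 1, 1, 0, 1, 1, 1, 0, 0, 1, 0, 1, 0, 1, 1]])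
    { length_eq := by decide
      pos := by decide
      le_succ := by decide
      sync := by decide +kernel
      ident := by decide +kernel
      k_pos := by decide
      gap_le := by decide
      directed := by decide +kernel
      short_le := by decide
      short := by decide +kernel }

/-! ### Colorings of trees by the distance to a root -/

/-- A sequence of levels with steps `±1` that never turns from up to down follows a valley. -/
theorem exists_eq_valley {f : ℕ → ℕ} {N : ℕ}
    (hstep : ∀ t < N, f t = f (t + 1) + 1 ∨ f (t + 1) = f t + 1)
    (hturn : ∀ t, t + 1 < N → f (t + 1) = f t + 1 → f (t + 2) = f (t + 1) + 1) :
    ∃ n, ∃ a ≤ N, ∀ t ≤ N, f t = valley n a t := by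
  induction N with
  | zero => exact ⟨f 0, 0, le_rfl, fun t ht => by obtain rfl : t = 0 := by omega
                                                  simp [valley]⟩
  | succ N ih =>
    obtain ⟨n, a, ha, h⟩ := ih (fun t ht => hstep t (by omega)) (fun t ht => hturn t (by omega))
    have hN := h N le_rfl
    rcases hstep N (by omega) with hs | hs
    · -- A last step down to a lower level is possible only if all steps were.
      have haN : a = N := by
        by_contra hne
        have h1 := h (N - 1) (by omega)
        have h2 := hturn (N - 1) (by omega) (by
          rw [show N - 1 + 1 = N by omega, hN, h1]; unfold valley; omega)
        rw [show N - 1 + 2 = N + 1 by omega, show N - 1 + 1 = N by omega] at h2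
        omega
      refine ⟨n - 1, N + 1, le_rfl, fun t ht => ?_⟩
      have hn : 0 < n := by unfold valley at hN; omega
      rcases Nat.lt_or_ge N t with htN | htN
      · obtain rfl : t = N + 1 := by omega
        unfold valley at hN ⊢
        omega
      · rw [h t htN]
        unfold valley
        omega
    · refine ⟨n, a, by omega, fun t ht => ?_⟩
      rcases Nat.lt_or_ge N t with htN | htN
      · obtain rfl : t = N + 1 := by omega
        unfold valley at hN ⊢
        omega
      · exact h t htN

section Tree

variable {V α : Type*} {G : SimpleGraph V}

/-- In a tree, a vertex has at most one neighbour closer to the root `r`. -/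
theorem SimpleGraph.IsTree.eq_of_adj_of_dist_lt (hG : G.IsTree) (r : V) {x y v : V}
    (hx : G.Adj v x) (hy : G.Adj v y) (hxd : G.dist r v = G.dist r x + 1)
    (hyd : G.dist r v = G.dist r y + 1) : x = y := by
  have key (x : V) (hx : G.Adj v x) (hxd : G.dist r v = G.dist r x + 1) :
      ∃ p : G.Walk r v, p.IsPath ∧ p.penultimate = x := by
    obtain ⟨p, -, hlen⟩ := (hG.connected r x).exists_path_of_dist
    refine ⟨p.concat hx.symm, ?_, by simp⟩
    refine SimpleGraph.Walk.isPath_of_length_eq_dist _ ?_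
    rw [SimpleGraph.Walk.length_concat, hlen, hxd]
  obtain ⟨p, hp, rfl⟩ := key x hx hxd
  obtain ⟨q, hq, rfl⟩ := key y hy hyd
  rw [(hG.existsUnique_path r v).unique hp hq]

theorem SimpleGraph.IsTree.exists_dist_eq_valley (hG : G.IsTree) (r : V) {u v : V}
    {w : G.Walk u v} (hw : w.IsPath) :
    ∃ n, ∃ a ≤ w.length, ∀ t ≤ w.length, G.dist r (w.getVert t) = valley n a t := by
  refine exists_eq_valley (fun t ht => ?_) fun t ht h => ?_
  · exact hG.dist_eq_dist_add_one_of_adj r (w.adj_getVert_succ ht)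
  · have h1 : G.Adj (w.getVert t) (w.getVert (t + 1)) := w.adj_getVert_succ (by omega)
    have h2 : G.Adj (w.getVert (t + 1)) (w.getVert (t + 2)) := w.adj_getVert_succ ht
    rcases hG.dist_eq_dist_add_one_of_adj r h2 with h' | h'
    · have := hw.getVert_injOn (by simp; omega) (by simp; omega)
        (hG.eq_of_adj_of_dist_lt r h1.symm h2 h h')
      omega
    · exact h'

theorem SimpleGraph.IsTree.avoidsSquares_comp_dist (hG : G.IsTree) (r : V) {k : ℕ} {c : ℕ → α}
    (hc : ValleySquareFree k c) : AvoidsSquares G k (fun v => c (G.dist r v)) := by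
  intro u v w hw p hkp ⟨x, hx, hsq⟩
  obtain ⟨n, a, ha, h⟩ := hG.exists_dist_eq_valley r hw
  have hlen : w.length + 1 = 2 * p := by
    have := congrArg List.length hsq
    simp only [List.length_map, SimpleGraph.Walk.length_support, List.length_append] at this
    omega
  have hlev (t : ℕ) (ht : t < 2 * p) : (x ++ x)[t]? = some (c (valley n a t)) := by
    rw [← hsq, List.getElem?_map, ← SimpleGraph.Walk.getVert_eq_support_getElem? _ (by omega),
      Option.map_some, h t (by omega)]
  have hper (t : ℕ) (ht : t < p) : c (valley n a t) = c (valley n a (t + p)) := by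
    have h1 := hlev t (by omega)
    have h2 := hlev (t + p) (by omega)
    rw [List.getElem?_append_left (by omega)] at h1
    rw [List.getElem?_append_right (by omega), hx, Nat.add_sub_cancel, h1] at h2
    exact Option.some.inj h2
  rcases lt_or_ge a p with hap | hap
  · obtain ⟨t, ht, hne⟩ := hc n a p hkp hap
    exact hne (hper t ht)
  · -- Reading the path backwards brings the lowest level into the first half.
    obtain ⟨t, ht, hne⟩ := hc n (2 * p - 1 - a) p hkp (by omega)
    refine hne ?_
    have := hper (p - 1 - t) (by omega)
    rw [eq_comm] at this
    convert this using 2 <;> (unfold valley; omega)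

end Tree

/-! ### Thue numbers of classes of graphs -/

section ThueNumber

variable {V α : Type*} {G : SimpleGraph V}

theorem AvoidsSquares.mono {k l : ℕ} {c : V → α} (h : AvoidsSquares G k c) (hkl : k ≤ l) :
    AvoidsSquares G l c :=
  fun u v w hw p hp => h u v w hw p (hkl.trans hp)

theorem AvoidsSquares.comp_injective {β : Type*} {k : ℕ} {c : V → α} (h : AvoidsSquares G k c)
    {f : α → β} (hf : Function.Injective f) : AvoidsSquares G k (f ∘ c) := by
  rintro u v w hw p hp ⟨x, hx, hsq⟩
  refine h u v w hw p hp ⟨(w.support.map c).take p, ?_, ?_⟩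
  · have := congrArg List.length hsq
    simp only [List.length_map, List.length_append] at this
    simp only [List.length_take, List.length_map]
    omega
  · rw [← List.map_map] at hsq
    refine List.map_injective_iff.2 hf ?_
    rw [List.map_append, List.map_take, hsq, List.take_left' hx]

theorem thueNumber_le {k n : ℕ} {c : V → Fin n} (h : AvoidsSquares G k c) :
    thueNumber k G ≤ n :=
  iInf₂_le n ⟨c, h⟩

theorem lt_thueNumber {k n : ℕ} (h : ∀ c : V → Fin n, ¬ AvoidsSquares G k c) :
    ((n + 1 : ℕ) : ℕ∞) ≤ thueNumber k G := by
  refine le_iInf₂ fun l ⟨c, hc⟩ => Nat.cast_le.2 ?_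
  by_contra! hl
  exact h _ (hc.comp_injective (Fin.castLE_injective (Nat.lt_succ_iff.1 hl)))

theorem thueNumber_anti_left {k l : ℕ} (hkl : k ≤ l) : thueNumber l G ≤ thueNumber k G :=
  le_iInf₂ fun _ ⟨_, hc⟩ => thueNumber_le (hc.mono hkl)

theorem classThueNumber_anti_left {C : ∀ V : Type u, SimpleGraph V → Prop} {k l : ℕ}
    (hkl : k ≤ l) : classThueNumber l C ≤ classThueNumber k C :=
  iSup_mono fun _ => iSup_mono fun _ => iSup_mono fun _ => thueNumber_anti_left hkl

theorem classThueNumber_mono {C D : ∀ V : Type u, SimpleGraph V → Prop} (k : ℕ)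
    (h : ∀ V G, C V G → D V G) : classThueNumber k C ≤ classThueNumber k D :=
  iSup_mono fun V => iSup_mono fun G => iSup_mono' fun hG => ⟨h V G hG, le_rfl⟩

theorem le_classThueNumber {C : ∀ V : Type u, SimpleGraph V → Prop} (k : ℕ) {V : Type u}
    {G : SimpleGraph V} (hG : C V G) : thueNumber k G ≤ classThueNumber k C :=
  le_iSup_of_le V (le_iSup_of_le G (le_iSup_of_le hG le_rfl))

theorem classThueNumber_treeClass_le {k l n : ℕ} (hkl : k ≤ l)
    (h : ∃ w : ℕ → Fin n, ValleySquareFree k w) : classThueNumber l TreeClass.{u} ≤ n := by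
  obtain ⟨w, hw⟩ := h
  refine iSup_le fun V => iSup_le fun G => iSup_le fun (hG : G.IsTree) => ?_
  obtain ⟨r⟩ := hG.connected.nonempty
  exact thueNumber_le ((hG.avoidsSquares_comp_dist r hw).mono hkl)

end ThueNumber

/-! ### A finite tree whose colorings contain level-colored binary trees -/

/-- The complete rooted tree of depth `D` in which every inner vertex has one child for each element
of `A`: its vertices are the words of length at most `D`, and the children of `l` are the words
`a :: l`. -/
def wordTree (A : Type*) (D : ℕ) : SimpleGraph {l : List A // l.length ≤ D} where
  Adj x y := (∃ a, y.1 = a :: x.1) ∨ ∃ a, x.1 = a :: y.1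
  symm := ⟨fun _ _ h => h.symm⟩
  loopless := ⟨fun x h => by
    rcases h with ⟨a, h⟩ | ⟨a, h⟩ <;> simpa using congrArg List.length h⟩

theorem isTree_wordTree (A : Type*) (D : ℕ) : (wordTree A D).IsTree := by
  constructor
  · have hroot : ∀ (l : List A) (hl : l.length ≤ D),
        (wordTree A D).Reachable ⟨[], Nat.zero_le _⟩ ⟨l, hl⟩ := by
      intro l
      induction l with
      | nil => exact fun _ => .refl _
      | cons a l ih =>
        intro hl
        have hl' : l.length ≤ D := by simp at hl; omega
        exact (ih hl').trans (SimpleGraph.Adj.reachable (Or.inl ⟨a, rfl⟩))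
    exact (SimpleGraph.connected_iff_exists_forall_reachable _).2 ⟨_, fun v => hroot v.1 v.2⟩
  · have key (x y : {l : List A // l.length ≤ D}) (a : A) (hy : y.1 = a :: x.1) :
        ¬ ((wordTree A D).deleteEdges {s(x, y)}).Reachable x y := by
      -- Without the edge between `x` and its child `y`, one cannot leave the descendants of `y`.
      rintro ⟨w⟩
      have hinv : ∀ u v, ((wordTree A D).deleteEdges {s(x, y)}).Walk u v →
          y.1 <:+ v.1 → y.1 <:+ u.1 := by
        intro u v w
        induction w with
        | nil => exact id
        | @cons u u' v h _ ih =>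
          intro hv
          have hu' := ih hv
          rw [SimpleGraph.deleteEdges_adj] at h
          obtain ⟨⟨b, hb⟩ | ⟨b, hb⟩, hne⟩ := h
          · rw [hb, List.suffix_cons_iff, ← hb] at hu'
            rcases hu' with hu' | hu'
            · have h1 : y = u' := Subtype.ext hu'
              have h2 : x = u := by
                subst h1
                rw [hy] at hb
                exact Subtype.ext (List.cons.inj hb).2
              subst h1 h2
              exact absurd rfl hne
            · exact hu'
          · rw [hb]
            exact hu'.trans (List.suffix_cons _ _)
      have := (hinv x y w (List.suffix_refl _)).length_le
      simp [hy] at this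
    rw [SimpleGraph.isAcyclic_iff_forall_adj_isBridge]
    intro x y hxy
    rw [SimpleGraph.isBridge_iff]
    rcases hxy with ⟨a, h⟩ | ⟨a, h⟩
    · exact key x y a h
    · rw [Sym2.eq_swap]
      exact fun hr => key y x a h hr.symm

/-- Below the vertex `l`, the coloring `c` contains a complete binary tree whose levels have, from
top to bottom, the colors `w`. -/
def HasLevels {A α : Type*} (c : List A → α) : List A → List α → Prop
  | _, [] => True
  | l, x :: w => c l = x ∧ ∃ a b, a ≠ b ∧ HasLevels c (a :: l) w ∧ HasLevels c (b :: l) w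

section Levels

variable {A α : Type*} {c : List A → α}

theorem HasLevels.exists_chain {l : List A} {w : List α} (h : HasLevels c l w) :
    ∃ vs : List (List A), vs.map c = w ∧ vs.IsChain (fun x y => ∃ a, y = a :: x) ∧
      (∀ v ∈ vs.head?, v = l) ∧ (∀ v ∈ vs, l <:+ v) ∧
      (∀ v ∈ vs, v.length < l.length + w.length) ∧ vs.Nodup := by
  induction w generalizing l with
  | nil => exact ⟨[], by simp⟩
  | cons x w ih =>
    obtain ⟨rfl, a, -, -, ha, -⟩ := h
    obtain ⟨vs, h1, h2, h3, h4, h5, h6⟩ := ih ha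
    refine ⟨l :: vs, by simp [h1], ?_, by simp, ?_, ?_, ?_⟩
    · exact List.isChain_cons.2 ⟨fun v hv => ⟨a, h3 v hv⟩, h2⟩
    · rintro v (_ | ⟨_, hv⟩)
      · exact List.suffix_refl _
      · exact (List.suffix_cons _ _).trans (h4 v hv)
    · rintro v (_ | ⟨_, hv⟩)
      · simp
      · have := h5 v hv
        simp only [List.length_cons] at this ⊢
        omega
    · refine List.nodup_cons.2 ⟨fun hl => ?_, h6⟩
      have := (h4 l hl).length_le
      simp at this

/-- The colors along a path that climbs to `l` from below one child and descends below another. -/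
theorem HasLevels.exists_path {D : ℕ} {l : List A} {a b : A} (hab : a ≠ b) {w : List α}
    (ha : HasLevels c (a :: l) w) (hb : HasLevels c (b :: l) w) (hD : l.length + w.length ≤ D)
    (i j : ℕ) :
    ∃ (u v : {l : List A // l.length ≤ D}) (p : (wordTree A D).Walk u v), p.IsPath ∧
      p.support.map (fun v => c v.1) = (w.take i).reverse ++ c l :: w.take j := by
  obtain ⟨vs, hc, hchain, hhead, hsuf, hlen, hnd⟩ := ha.exists_chain
  obtain ⟨vs', hc', hchain', hhead', hsuf', hlen', hnd'⟩ := hb.exists_chain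
  set ps : List (List A) := (vs.take i).reverse ++ l :: vs'.take j with hps
  have hps_len : ∀ v ∈ ps, v.length ≤ D := by
    intro v hv
    simp only [hps, List.mem_append, List.mem_reverse, List.mem_cons] at hv
    rcases hv with hv | rfl | hv
    · have := hlen v (List.mem_of_mem_take hv)
      simp only [List.length_cons] at this
      omega
    · omega
    · have := hlen' v (List.mem_of_mem_take hv)
      simp only [List.length_cons] at this
      omega
  have hps_chain : ps.IsChain (fun x y => (∃ a, y = a :: x) ∨ ∃ a, x = a :: y) := by
    have hdown : (l :: vs'.take j).IsChain (fun x y => ∃ a, y = a :: x) := by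
      refine List.isChain_cons.2 ⟨fun v hv => ⟨b, hhead' v ?_⟩, hchain'.take j⟩
      rw [List.head?_take] at hv
      split_ifs at hv
      · simp at hv
      · exact hv
    refine List.isChain_append.2 ⟨?_, hdown.imp fun _ _ => Or.inl, ?_⟩
    · rw [List.isChain_reverse]
      exact (hchain.take i).imp fun _ _ => Or.inr
    · intro x hx y hy
      rw [List.getLast?_reverse, List.head?_take] at hx
      split_ifs at hx
      · simp at hx
      · simp only [List.head?_cons, Option.mem_some_iff] at hy
        subst hy
        exact Or.inr ⟨a, hhead x hx⟩
  have hps_nodup : ps.Nodup := by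
    have hnot (v : List A) (hv : v = l ∨ v ∈ vs') : v ∉ vs := by
      intro hv'
      have h1 := hsuf v hv'
      rcases hv with rfl | hv
      · simpa using h1.length_le
      · have := (List.suffix_of_suffix_length_le h1 (hsuf' v hv) (by simp)).eq_of_length (by simp)
        exact hab (List.cons.inj this).1
    refine List.nodup_append.2 ⟨List.nodup_reverse.2 (hnd.sublist (List.take_sublist _ _)),
      List.nodup_cons.2 ⟨fun h => ?_, hnd'.sublist (List.take_sublist _ _)⟩, ?_⟩
    · simpa using (hsuf' l (List.mem_of_mem_take h)).length_le
    · rintro x hx y hy rfl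
      refine hnot x ?_ (List.mem_of_mem_take (List.mem_reverse.1 hx))
      rcases List.mem_cons.1 hy with rfl | hy
      · exact Or.inl rfl
      · exact Or.inr (List.mem_of_mem_take hy)
  have hps_map : ps.map c = (w.take i).reverse ++ c l :: w.take j := by
    rw [hps, List.map_append, List.map_reverse, List.map_cons, List.map_take, List.map_take, hc,
      hc']
  clear_value ps
  lift ps to List {l : List A // l.length ≤ D} using hps_len
  have hadj : ps.IsChain (wordTree A D).Adj := (List.isChain_map Subtype.val).1 hps_chain
  have hne : ps ≠ [] := by
    rintro rfl
    simpa using congrArg List.length hps_map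
  refine ⟨_, _, SimpleGraph.Walk.ofSupport ps hne hadj, ?_, ?_⟩
  · rw [SimpleGraph.Walk.isPath_def, SimpleGraph.Walk.support_ofSupport]
    exact hps_nodup.of_map _
  · rw [SimpleGraph.Walk.support_ofSupport, ← hps_map, List.map_map]
    rfl

end Levels

/-! ### Good words: the possible colors along the levels -/

/-- No path through the top of a tree whose levels have, from top to bottom, the colors `x :: w`
carries a square of period at least `k`. -/
def NoTopSquare {α : Type*} (k : ℕ) (x : α) (w : List α) : Prop :=
  ∀ i ≤ w.length, ∀ j ≤ w.length, k ≤ (i + j + 1) / 2 →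
    ((w.take i).reverse ++ x :: w.take j).take ((i + j + 1) / 2) ≠
      ((w.take i).reverse ++ x :: w.take j).drop ((i + j + 1) / 2)

instance {α : Type*} [DecidableEq α] (k : ℕ) (x : α) (w : List α) : Decidable (NoTopSquare k x w) :=
  inferInstanceAs (Decidable (∀ i ≤ w.length, ∀ j ≤ w.length, k ≤ (i + j + 1) / 2 →
    ((w.take i).reverse ++ x :: w.take j).take ((i + j + 1) / 2) ≠
      ((w.take i).reverse ++ x :: w.take j).drop ((i + j + 1) / 2)))

/-- The words of a given length over `n` letters all of whose nonempty suffixes satisfy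
`NoTopSquare k`: the colors, from top to bottom, of level-colored trees without squares of period at
least `k`. -/
def goodWords (n k : ℕ) : ℕ → List (List (Fin n))
  | 0 => [[]]
  | len + 1 => (goodWords n k len).flatMap fun w =>
      ((List.finRange n).filter fun x => decide (NoTopSquare k x w)).map (· :: w)

theorem cons_mem_goodWords {n k len : ℕ} {x : Fin n} {w : List (Fin n)}
    (hw : w ∈ goodWords n k len) (hx : NoTopSquare k x w) : x :: w ∈ goodWords n k (len + 1) :=
  List.mem_flatMap.2 ⟨w, hw, List.mem_map.2 ⟨x, by simpa using hx, rfl⟩⟩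

theorem exists_of_mem_goodWords_succ {n k len : ℕ} {v : List (Fin n)}
    (hv : v ∈ goodWords n k (len + 1)) :
    ∃ x w, v = x :: w ∧ w ∈ goodWords n k len ∧ NoTopSquare k x w := by
  obtain ⟨w, hw, h⟩ := List.mem_flatMap.1 hv
  obtain ⟨x, hx, rfl⟩ := List.mem_map.1 h
  exact ⟨x, w, rfl, hw, by simpa using hx⟩

theorem length_of_mem_goodWords {n k len : ℕ} {w : List (Fin n)} (hw : w ∈ goodWords n k len) :
    w.length = len := by
  induction len generalizing w with
  | zero => simpa [goodWords] using hw
  | succ len ih =>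
    obtain ⟨x, w, rfl, hw, -⟩ := exists_of_mem_goodWords_succ hw
    simp [ih hw]

/-- If every vertex has more children than there are good words of each length, then, by the
pigeonhole principle applied at each level from the bottom up, a coloring without squares contains
level-colored binary trees below each vertex. -/
theorem exists_hasLevels {A : Type*} [Fintype A] {n k D : ℕ}
    (hA : ∀ len ≤ D, (goodWords n k len).length < Fintype.card A)
    {c : List A → Fin n} (hc : AvoidsSquares (wordTree A D) k fun v => c v.1)
    {len : ℕ} (l : List A) (hl : l.length + len ≤ D + 1) :
    ∃ w ∈ goodWords n k len, HasLevels c l w := by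
  classical
  induction len generalizing l with
  | zero => exact ⟨[], by simp [goodWords], trivial⟩
  | succ len ih =>
    have hchild (a : A) : ∃ w ∈ goodWords n k len, HasLevels c (a :: l) w :=
      ih (a :: l) (by simp only [List.length_cons]; omega)
    choose f hf hlev using hchild
    obtain ⟨a, -, b, -, hab, hfab⟩ := Finset.exists_ne_map_eq_of_card_lt_of_maps_to
      (s := Finset.univ) (t := (goodWords n k len).toFinset) (f := f)
      ((List.toFinset_card_le _).trans_lt (hA len (by omega))) (fun a _ => by simpa using hf a)
    have hb := hlev b
    rw [← hfab] at hb
    refine ⟨c l :: f a, cons_mem_goodWords (hf a) ?_, rfl, a, b, hab, hlev a, hb⟩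
    intro i hi j hj hk heq
    have hlen := length_of_mem_goodWords (hf a)
    obtain ⟨u, v, p, hp, hcol⟩ := (hlev a).exists_path (D := D) hab hb (by omega) i j
    refine hc u v p hp _ hk ?_
    rw [hcol]
    -- The two halves have the same length because they are equal.
    have h := congrArg List.length heq
    simp only [List.length_take, List.length_drop, List.length_append, List.length_reverse,
      List.length_cons] at h
    refine ⟨_, ?_, (List.take_append_drop ((i + j + 1) / 2) _).symm.trans
      (congrArg _ heq.symm)⟩
    simp only [List.length_take, List.length_append, List.length_reverse, List.length_cons]
    omega

theorem le_classThueNumber_finiteTreeClass {n k D : ℕ} (h : goodWords n k (D + 1) = []) :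
    ((n + 1 : ℕ) : ℕ∞) ≤ classThueNumber k FiniteTreeClass.{u} := by
  let A : Type u := ULift (Fin (∑ i ∈ Finset.range (D + 1), (goodWords n k i).length + 1))
  have hA (len : ℕ) (hlen : len ≤ D) : (goodWords n k len).length < Fintype.card A := by
    rw [Fintype.card_ulift, Fintype.card_fin, Nat.lt_succ_iff]
    exact Finset.single_le_sum (f := fun i => (goodWords n k i).length) (fun _ _ => Nat.zero_le _)
      (Finset.mem_range.2 (Nat.lt_succ_iff.2 hlen))
  have hfin : Finite {l : List A // l.length ≤ D} := (List.finite_length_le A D).to_subtype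
  refine (lt_thueNumber fun c hc => ?_).trans (le_classThueNumber k ⟨hfin, isTree_wordTree A D⟩)
  let c' : List A → Fin n := fun l => if hl : l.length ≤ D then c ⟨l, hl⟩ else c ⟨[], Nat.zero_le _⟩
  have hc' : (fun v : {l : List A // l.length ≤ D} => c' v.1) = c := by
    funext v
    simp [c', v.2]
  obtain ⟨w, hw, -⟩ := exists_hasLevels (c := c') hA (hc'.symm ▸ hc) (len := D + 1) [] (by simp)
  simp [h] at hw

/-- A word of length `2 * k` over one letter is a square. -/
theorem goodWords_one_eq_nil {k : ℕ} (hk : 0 < k) : goodWords 1 k (2 * k - 1 + 1) = [] := by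
  refine List.eq_nil_iff_forall_not_mem.2 fun v hv => ?_
  obtain ⟨x, w, rfl, hw, h⟩ := exists_of_mem_goodWords_succ hv
  have hlen := length_of_mem_goodWords hw
  have hhalf : (0 + w.length + 1) / 2 = k := by omega
  refine h 0 (Nat.zero_le _) w.length le_rfl (by omega) ?_
  rw [hhalf]
  refine List.ext_getElem ?_ fun _ _ _ => Subsingleton.elim _ _
  simp only [List.length_take, List.length_drop, List.length_append, List.length_reverse,
    List.length_cons]
  omega

theorem goodWords_two_eq_nil : goodWords 2 4 (14 + 1) = [] := by decide +kernel

theorem goodWords_three_eq_nil : goodWords 3 1 (5 + 1) = [] := by decide +kernel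

/-- The classes of finite trees and of all trees have the same Thue number `n + 1` as soon as good
words over `n` letters have bounded length and the valley condition holds for some infinite word
over `n + 1` letters. -/
theorem classThueNumber_eq {n k l m D : ℕ} (hkl : k ≤ l) (hlm : l ≤ m)
    (hlow : goodWords n m (D + 1) = []) (hup : ∃ w : ℕ → Fin (n + 1), ValleySquareFree k w) :
    classThueNumber l FiniteTreeClass.{u} = (n + 1 : ℕ) ∧
      classThueNumber l TreeClass.{u} = (n + 1 : ℕ) := by
  have h1 : classThueNumber l TreeClass.{u} ≤ (n + 1 : ℕ) := classThueNumber_treeClass_le hkl hup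
  have h2 : ((n + 1 : ℕ) : ℕ∞) ≤ classThueNumber l FiniteTreeClass.{u} :=
    (le_classThueNumber_finiteTreeClass hlow).trans (classThueNumber_anti_left hlm)
  have h3 : classThueNumber l FiniteTreeClass.{u} ≤ classThueNumber l TreeClass.{u} :=
    classThueNumber_mono l fun _ _ h => h.2
  exact ⟨(h3.trans h1).antisymm h2, h1.antisymm (h2.trans h3)⟩

theorem theorem3 :
    (classThueNumber 1 FiniteTreeClass.{u} = 4 ∧
      (∀ k : ℕ, 2 ≤ k → k ≤ 4 → classThueNumber k FiniteTreeClass.{u} = 3) ∧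
      (∀ k : ℕ, 5 ≤ k → classThueNumber k FiniteTreeClass.{u} = 2)) ∧
    (classThueNumber 1 TreeClass.{u} = 4 ∧
      (∀ k : ℕ, 2 ≤ k → k ≤ 4 → classThueNumber k TreeClass.{u} = 3) ∧
      (∀ k : ℕ, 5 ≤ k → classThueNumber k TreeClass.{u} = 2)) := by
  have four := classThueNumber_eq.{u} le_rfl le_rfl goodWords_three_eq_nil
    exists_valleySquareFree_four
  have three (k : ℕ) (h2 : 2 ≤ k) (h4 : k ≤ 4) :=
    classThueNumber_eq.{u} h2 h4 goodWords_two_eq_nil exists_valleySquareFree_three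
  have two (k : ℕ) (h5 : 5 ≤ k) :=
    classThueNumber_eq.{u} h5 le_rfl (goodWords_one_eq_nil (by omega)) exists_valleySquareFree_two
  exact ⟨⟨four.1, fun k h2 h4 => (three k h2 h4).1, fun k h5 => (two k h5).1⟩,
    four.2, fun k h2 h4 => (three k h2 h4).2, fun k h5 => (two k h5).2⟩
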